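/- Let $A$ be a finite set and let $\mathcal E$ be the set of undirected edges $\{x,y\}$, $x,y\in A$, including the self-edges ($x=y$). Let $\theta:\mathcal E\to\mathbb R$ be a (real, signed) weight, and let $q$ be the symmetric weight on directed edges $q(x,y)=\theta_{xy}/2$ for $x\ne y$ and $q(x,x)=\theta_{xx}$. Write $Q=[q(x,y)]_{x,y\in A}$ and $D=\det(I-Q)$. Assume that $\theta$ is integrable, that is, the matrix $[|q(x,y)|]$ has no real eigenvalue $\ge 1$. A rooted loop is a sequence $l=[l_0,l_1,\dots,l_n]$ in $A$ with $n\ge1$ and $l_n=l_0$; its length is $|l|=n$ and its weight is $q(l)=\prod_{j=1}^n q(l_{j-1},l_j)$. An unrooted loop $\ell$ is an equivalence class of rooted loops under cyclic change of the root, and the loop measure is $m(\ell)=\sum_{l\in\ell} q(l)/|l|$, the sum being over the distinct representatives of $\ell$. Let $\mathcal L$ be the set of unrooted loops. The loop soup at time (intensity) $t$ is the signed measure on finite multisets $N:\mathcal L\to\mathbb N$ given by \[ \nu_t(N)=e^{-t\,m(\mathcal L)}\prod_{\ell\in\mathcal L}\frac{(t\,m(\ell))^{N(\ell)}}{N(\ell)!}.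 \] For $\bar k=(k_e)\in\mathbb N^{\mathcal E}$ and $x\in A$ let $n_x=n_x(\bar k)=\frac12\sum_{e\in\mathcal E}k_e\,n_e(x)$ be the vertex local time, where $n_e(x)=2$ if $e$ is the self-edge at $x$, $n_e(x)=1$ if $e$ joins $x$ to a different vertex, and $n_e(x)=0$ otherwise. Call $\bar k$ an (undirected) current if every $n_x$ is an integer. Each finite multiset $N$ of unrooted loops determines $\bar k(N)\in\mathbb N^{\mathcal E}$, where $k_e(N)$ is the total number of traversals of $e$, in either direction, by the loops of $N$ counted with multiplicity. Let $\mu(\bar k)=\sum_{N:\,\bar k(N)=\bar k}\nu_{1/2}(N)$. Then $\sum_{\ell}|m(\ell)|<\infty$, $\sum_N|\nu_{1/2}(N)|<\infty$, every $\bar k(N)$ is a current (so that $\mu$ is a signed measure on currents), $D>0$, and for every current $\bar k$ \[ \mu(\bar k)=\sqrt D\,\left[\prod_{x\in A}\frac{\Gamma(n_x+\frac12)}{\sqrt\pi}\right]\left[\prod_{e\in\mathcal E}\frac1{k_e!}\right]\prod_{e\in\mathcal E}\theta_e^{k_e}. \] -/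

import Mathlib

noncomputable section

namespace LoopSoup

/-! Undirected edges of `A` are the elements of `Sym2 A`; self-edges `s(x, x)` are included. -/

/-- The symmetric weight on directed edges given by a weight `θ` on undirected edges:
`q(x,y) = θ_{xy} / 2` for `x ≠ y` and `q(x,x) = θ_{xx}`. -/
def directedWeight {A : Type*} [DecidableEq A] (θ : Sym2 A → ℝ) : Matrix A A ℝ :=
  fun x y => if x = y then θ s(x, y) else θ s(x, y) / 2

/-- A weight `q` on directed edges is integrable if the largest positive eigenvalue of the
matrix `[|q(x,y)|]` is strictly less than one, i.e. no real eigenvalue is `≥ 1`. -/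
def IsIntegrableWeight {A : Type*} [Fintype A] [DecidableEq A] (q : Matrix A A ℝ) : Prop :=
  ∀ r : ℝ, Module.End.HasEigenvalue (Matrix.toLin' (q.map fun a => |a|)) r → r < 1

/-! ### Loops -/

/-- A nontrivial rooted loop in `A`. The nonempty list `[a₀, …, aₙ₋₁]` stands for the loop
`[a₀, a₁, …, aₙ₋₁, a₀]` of length `n ≥ 1` rooted at `a₀`. -/
def RootedLoop (A : Type*) : Type _ := {l : List A // l ≠ []}

/-- The length (number of steps) of a rooted loop. -/
def RootedLoop.len {A : Type*} (l : RootedLoop A) : ℕ := l.1.length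

/-- The directed edges `(a₀,a₁), …, (aₙ₋₂,aₙ₋₁), (aₙ₋₁,a₀)` traversed by the loop, in order. -/
def RootedLoop.edges {A : Type*} (l : RootedLoop A) : List (A × A) :=
  l.1.zip (l.1.rotate 1)

/-- The weight `q(l)` of a loop: the product of the weights of its steps. -/
def RootedLoop.weight {A : Type*} (q : Matrix A A ℝ) (l : RootedLoop A) : ℝ :=
  (l.edges.map fun p => q p.1 p.2).prod

/-- The rooted loop measure `q(l) / |l|`. -/
def rootedLoopMeasure {A : Type*} (q : Matrix A A ℝ) (l : RootedLoop A) : ℝ :=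
  l.weight q / (l.len : ℝ)

/-- The number of times that a rooted loop traverses each undirected edge, in either direction. -/
def RootedLoop.current {A : Type*} [DecidableEq A] (l : RootedLoop A) (e : Sym2 A) : ℕ :=
  (l.edges.map fun p => s(p.1, p.2)).count e

/-- Two rooted loops are equivalent if they differ by the choice of the starting point. -/
instance rotationSetoid (A : Type*) : Setoid (RootedLoop A) where
  r l l' := l.1 ~r l'.1
  iseqv := ⟨fun l => List.IsRotated.refl l.1, fun h => List.IsRotated.symm h,
    fun h h' => List.IsRotated.trans h h'⟩

/-- (Oriented) unrooted loops. -/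
def UnrootedLoop (A : Type*) : Type _ := Quotient (rotationSetoid A)

/-- The unrooted loop corresponding to a rooted loop. -/
def RootedLoop.forget {A : Type*} (l : RootedLoop A) : UnrootedLoop A :=
  Quotient.mk (rotationSetoid A) l

/-- An unrooted loop has finitely many representatives. -/
theorem finite_representatives {A : Type*} (ℓ : UnrootedLoop A) :
    {l : RootedLoop A | l.forget = ℓ}.Finite := by
  obtain ⟨l₀, rfl⟩ := Quotient.exists_rep ℓ
  have h : {l : List A | l ∈ l₀.1.cyclicPermutations}.Finite := List.finite_toSet _
  refine Set.Finite.of_finite_image (f := Subtype.val) (h.subset ?_)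
    Subtype.val_injective.injOn
  rintro _ ⟨l, hl, rfl⟩
  have h' : l.1 ~r l₀.1 := Quotient.exact hl
  simpa using h'

/-- The unrooted loop measure: the sum of the rooted loop measure over the (finitely many)
distinct representatives. -/
def loopMeasure {A : Type*} (q : Matrix A A ℝ) (ℓ : UnrootedLoop A) : ℝ :=
  ∑ᶠ l ∈ {l : RootedLoop A | l.forget = ℓ}, rootedLoopMeasure q l

theorem RootedLoop.edges_perm {A : Type*} {l l' : RootedLoop A} (h : l.1 ~r l'.1) :
    l.edges.Perm l'.edges := by
  obtain ⟨n, hn⟩ := h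
  have e : l'.edges = l.edges.rotate n := by
    unfold RootedLoop.edges
    rw [← hn, List.zip_eq_zipWith, List.zip_eq_zipWith,
      List.zipWith_rotate_distrib _ _ _ _ (by simp), List.rotate_rotate, List.rotate_rotate, Nat.add_comm]
  rw [e]
  exact (List.rotate_perm _ _).symm

/-- The number of times that an unrooted loop traverses each undirected edge. -/
def UnrootedLoop.current {A : Type*} [DecidableEq A] (ℓ : UnrootedLoop A) : Sym2 A → ℕ :=
  Quotient.lift (s := rotationSetoid A) RootedLoop.current
    (fun _ _ h => funext fun e => ((RootedLoop.edges_perm h).map _).count_eq e) ℓ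

/-! ### Soups -/

/-- The distribution at time `t` of the soup of a real (signed) measure `m` on a set `X`, as a
function on finite multisets `N : X →₀ ℕ`:
`ν_t(N) = exp(-t m(X)) ∏_x (t m(x))^{N(x)} / N(x)!`. -/
def soup {X : Type*} (m : X → ℝ) (t : ℝ) (N : X →₀ ℕ) : ℝ :=
  Real.exp (-t * ∑' x, m x) * N.prod fun x n => (t * m x) ^ n / (n.factorial : ℝ)

/-- The loop soup at time `t`: the soup of the unrooted loop measure. -/
def loopSoup {A : Type*} (q : Matrix A A ℝ) (t : ℝ) (N : UnrootedLoop A →₀ ℕ) : ℝ :=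
  soup (loopMeasure q) t N

/-! ### Currents -/

/-- The number of times that the edge `e` touches `x`: two for a self-edge at `x`, one for an edge
from `x` to a different vertex, zero otherwise. -/
def touch {A : Type*} [DecidableEq A] (e : Sym2 A) (x : A) : ℕ :=
  if e = s(x, x) then 2 else if x ∈ e then 1 else 0

/-- The vertex local time `n_x(k) = (1/2) ∑_e k_e n_e(x)`. -/
def localTime {A : Type*} [Fintype A] [DecidableEq A] (k : Sym2 A → ℕ) (x : A) : ℝ :=
  (1 / 2 : ℝ) * ∑ e : Sym2 A, (k e : ℝ) * (touch e x : ℝ)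

/-- `k` is an undirected current if all its vertex local times are integers. -/
def IsCurrent {A : Type*} [Fintype A] [DecidableEq A] (k : Sym2 A → ℕ) : Prop :=
  ∀ x : A, ∃ n : ℤ, localTime k x = (n : ℝ)

/-- The total number of traversals of each undirected edge by a multiset of unrooted loops. -/
def soupCurrent {A : Type*} [DecidableEq A] (N : UnrootedLoop A →₀ ℕ) : Sym2 A → ℕ :=
  N.sum fun ℓ n => n • ℓ.current

/-- The measure on edge counts induced by the loop soup at time `t`: its mass at `k` is the total
`ν_t`-mass of the multisets of loops whose edge traversal counts are `k`. -/
def currentMeasure {A : Type*} [DecidableEq A] (q : Matrix A A ℝ) (t : ℝ) (k : Sym2 A → ℕ) : ℝ :=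
  ∑' N : {N : UnrootedLoop A →₀ ℕ // soupCurrent N = k}, loopSoup q t N.1

end LoopSoup

end

noncomputable section

namespace LoopSoup

/-- The quadratic form of `|q|` is at most `r` times the square norm on nonnegative vectors. -/
def AbsFormBound {A : Type*} [Fintype A] (q : Matrix A A ℝ) (r : ℝ) : Prop :=
  ∀ v : A → ℝ, (∀ x, 0 ≤ v x) → ∑ x, ∑ y, |q x y| * v x * v y ≤ r * ∑ x, v x ^ 2

section LinearAlgebra

variable {A : Type*} [Fintype A]

theorem AbsFormBound.mono {p q : Matrix A A ℝ} {r : ℝ} (h : AbsFormBound q r)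
    (hpq : ∀ x y, |p x y| ≤ |q x y|) : AbsFormBound p r := fun v hv =>
  (Finset.sum_le_sum fun x _ => Finset.sum_le_sum fun y _ =>
    mul_le_mul_of_nonneg_right (mul_le_mul_of_nonneg_right (hpq x y) (hv x)) (hv y)).trans (h v hv)

theorem dotProduct_mulVec_eq_sum (q : Matrix A A ℝ) (v : A → ℝ) :
    v ⬝ᵥ q.mulVec v = ∑ x, ∑ y, q x y * v x * v y := by
  simp only [dotProduct, Matrix.mulVec, Finset.mul_sum]
  exact Finset.sum_congr rfl fun x _ => Finset.sum_congr rfl fun y _ => by ring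

theorem AbsFormBound.abs_dotProduct_le {q : Matrix A A ℝ} {r : ℝ} (h : AbsFormBound q r)
    (v : A → ℝ) : |v ⬝ᵥ q.mulVec v| ≤ r * ∑ x, v x ^ 2 := by
  have h1 := h (fun x => |v x|) fun x => abs_nonneg _
  simp only [sq_abs] at h1
  refine le_trans ?_ h1
  rw [dotProduct_mulVec_eq_sum]
  refine (Finset.abs_sum_le_sum_abs _ _).trans (Finset.sum_le_sum fun x _ =>
    (Finset.abs_sum_le_sum_abs _ _).trans (Finset.sum_le_sum fun y _ => ?_))
  rw [abs_mul, abs_mul]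

variable [DecidableEq A]

theorem exists_absFormBound {q : Matrix A A ℝ} (hq : q.IsSymm) (h : IsIntegrableWeight q) :
    ∃ r, 0 ≤ r ∧ r < 1 ∧ AbsFormBound q r := by
  set B : Matrix A A ℝ := q.map fun a => |a|
  have hB : B.IsHermitian := by
    ext x y
    simp [B, hq.apply x y]
  have hfin : (insert 0 (spectrum ℝ B)).Finite := (Matrix.finite_real_spectrum (𝕜 := ℝ)).insert 0
  obtain ⟨r, hr, hmax⟩ := Set.exists_max_image _ id hfin (Set.insert_nonempty _ _)
  refine ⟨r, hmax 0 (Set.mem_insert _ _), ?_, ?_⟩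
  · rcases hr with rfl | hr
    · exact one_pos
    · refine h r ?_
      rw [Module.End.hasEigenvalue_iff_mem_spectrum, Matrix.spectrum_toLin']
      exact hr
  · have hC : (r • (1 : Matrix A A ℝ) - B).IsHermitian := by
      refine Matrix.IsHermitian.sub ?_ hB
      ext x y
      simp [Matrix.one_apply, eq_comm]
    have hpsd : (r • (1 : Matrix A A ℝ) - B).PosSemidef := by
      rw [hC.posSemidef_iff_eigenvalues_nonneg]
      intro i
      have hi := hC.eigenvalues_mem_spectrum_real i
      set μ := hC.eigenvalues i
      have : r - μ ∈ spectrum ℝ B := by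
        rw [spectrum.mem_iff] at hi ⊢
        convert! (IsUnit.neg_iff _).not.2 hi using 2
        simp only [Algebra.algebraMap_eq_smul_one, sub_smul]
        abel
      have := hmax _ (Set.mem_insert_of_mem _ this)
      simp only [id] at this
      change (0 : ℝ) ≤ μ
      linarith
    intro v _
    have h2 := hpsd.dotProduct_mulVec_nonneg v
    simp only [star_trivial, Matrix.sub_mulVec, Matrix.smul_mulVec, Matrix.one_mulVec,
      dotProduct_sub, dotProduct_mulVec_eq_sum B] at h2
    have h3 : v ⬝ᵥ r • v = r * ∑ x, v x ^ 2 := by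
      simp [dotProduct, Finset.mul_sum]
      exact Finset.sum_congr rfl fun x _ => by ring
    rw [h3] at h2
    simp only [B, Matrix.map_apply] at h2
    linarith

variable {q : Matrix A A ℝ} {r : ℝ}

theorem AbsFormBound.abs_eigenvalues_le (h : AbsFormBound q r) (hq : q.IsHermitian) (i : A) :
    |hq.eigenvalues i| ≤ r := by
  set v : A → ℝ := ⇑(hq.eigenvectorBasis i)
  have h1 := h.abs_dotProduct_le v
  have h2 : q.mulVec v = hq.eigenvalues i • v := hq.mulVec_eigenvectorBasis i
  have h3 : ∑ x, v x ^ 2 = 1 := by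
    have := hq.eigenvectorBasis.orthonormal.1 i
    rw [EuclideanSpace.norm_eq, Real.sqrt_eq_one] at this
    simpa using this
  have h4 : v ⬝ᵥ v = 1 := by
    rw [← h3]; exact Finset.sum_congr rfl fun x _ => by ring
  rw [h2, dotProduct_smul, h4, h3] at h1
  simpa using h1

theorem trace_pow_eq_sum_eigenvalues (hq : q.IsHermitian) (n : ℕ) :
    (q ^ n).trace = ∑ i, hq.eigenvalues i ^ n := by
  conv_lhs => rw [hq.spectral_theorem, ← map_pow, Unitary.conjStarAlgAut_apply,
    Matrix.trace_mul_cycle, Unitary.coe_star_mul_self, one_mul, Matrix.diagonal_pow,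
    Matrix.trace_diagonal]
  simp

theorem det_one_sub_eq_prod_eigenvalues (hq : q.IsHermitian) :
    (1 - q).det = ∏ i, (1 - hq.eigenvalues i) := by
  have := congrArg (Polynomial.eval 1) hq.charpoly_eq
  rw [Matrix.eval_charpoly, Polynomial.eval_prod] at this
  simpa using this

theorem AbsFormBound.det_one_sub_pos (h : AbsFormBound q r) (hr : r < 1) (hq : q.IsHermitian) :
    0 < (1 - q).det := by
  rw [det_one_sub_eq_prod_eigenvalues hq]
  refine Finset.prod_pos fun i _ => ?_
  have := (le_abs_self _).trans (h.abs_eigenvalues_le hq i)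
  linarith

theorem AbsFormBound.hasSum_trace_pow (h : AbsFormBound q r) (hr : r < 1) (hq : q.IsHermitian) :
    HasSum (fun n : ℕ => (q ^ (n + 1)).trace / ((n : ℝ) + 1)) (-Real.log (1 - q).det) := by
  have hlt : ∀ i, |hq.eigenvalues i| < 1 := fun i => (h.abs_eigenvalues_le hq i).trans_lt hr
  rw [det_one_sub_eq_prod_eigenvalues hq, Real.log_prod, ← Finset.sum_neg_distrib]
  · simp only [trace_pow_eq_sum_eigenvalues hq, Finset.sum_div]
    exact hasSum_sum fun i _ => Real.hasSum_pow_div_log_of_abs_lt_one (hlt i)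
  · intro i _
    have := (abs_lt.1 (hlt i)).2
    linarith

theorem AbsFormBound.posDef_one_sub (h : AbsFormBound q r) (hr : r < 1) (hq : q.IsHermitian) :
    (1 - q).PosDef := by
  refine Matrix.PosDef.of_dotProduct_mulVec_pos (Matrix.isHermitian_one.sub hq) fun v hv => ?_
  have h1 := (abs_le.1 (h.abs_dotProduct_le v)).2
  have h2 : v ⬝ᵥ v = ∑ x, v x ^ 2 := Finset.sum_congr rfl fun x _ => by ring
  have h3 : 0 < v ⬝ᵥ v := by simpa using Matrix.dotProduct_star_self_pos_iff.2 hv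
  simp only [star_trivial, Matrix.sub_mulVec, Matrix.one_mulVec, dotProduct_sub]
  rw [← h2] at h1
  nlinarith

end LinearAlgebra

section Loops

/-- The weight of the path that starts at `a`, visits the vertices of `l` and ends at `b`. -/
def pathWeight {A : Type*} (q : Matrix A A ℝ) (b : A) : A → List A → ℝ
  | a, [] => q a b
  | a, c :: l => q a c * pathWeight q b c l

variable {A : Type*}

theorem prod_map_zip_eq_pathWeight (q : Matrix A A ℝ) (a b : A) (l : List A) :
    (((a :: l).zip (l ++ [b])).map fun p => q p.1 p.2).prod = pathWeight q b a l := by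
  induction l generalizing a with
  | nil => simp [pathWeight]
  | cons c l ih => simpa [pathWeight] using Or.inl (ih c)

theorem RootedLoop.weight_cons (q : Matrix A A ℝ) (a : A) (l : List A) :
    RootedLoop.weight q ⟨a :: l, List.cons_ne_nil a l⟩ = pathWeight q a a l := by
  simp only [RootedLoop.weight, RootedLoop.edges, List.rotate_cons_succ, List.rotate_zero]
  exact prod_map_zip_eq_pathWeight q a a l

theorem sum_pathWeight [Fintype A] [DecidableEq A] (q : Matrix A A ℝ) (n : ℕ) (a b : A) :
    ∑ f : Fin n → A, pathWeight q b a (List.ofFn f) = (q ^ (n + 1)) a b := by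
  induction n generalizing a with
  | zero => simp [pathWeight]
  | succ n ih =>
    rw [← (Fin.consEquiv fun _ : Fin (n + 1) => A).sum_comp, Fintype.sum_prod_type, pow_succ',
      Matrix.mul_apply]
    refine Finset.sum_congr rfl fun c _ => ?_
    rw [← ih, Finset.mul_sum]
    refine Finset.sum_congr rfl fun f _ => ?_
    simp [Fin.consEquiv, List.ofFn_succ, pathWeight]

/-- A rooted loop with `n + 1` steps is given by its root and its other `n` vertices. -/
def loopEquiv (A : Type*) : (Σ n : ℕ, A × (Fin n → A)) ≃ RootedLoop A :=
  Equiv.ofBijective (fun p => ⟨p.2.1 :: List.ofFn p.2.2, List.cons_ne_nil _ _⟩) <| by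
    constructor
    · rintro ⟨n, a, f⟩ ⟨m, b, g⟩ h
      have h' := Subtype.ext_iff.1 h
      simp only [List.cons.injEq] at h'
      obtain ⟨rfl, h'⟩ := h'
      have h2 : (⟨n, f⟩ : Σ n, Fin n → A) = ⟨m, g⟩ := List.equivSigmaTuple.symm.injective h'
      cases h2
      rfl
    · rintro ⟨_ | ⟨a, l⟩, hl⟩
      · exact absurd rfl hl
      · exact ⟨⟨l.length, a, l.get⟩, Subtype.ext (by simp)⟩

theorem rootedLoopMeasure_loopEquiv (q : Matrix A A ℝ) (n : ℕ) (a : A) (f : Fin n → A) :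
    rootedLoopMeasure q (loopEquiv A ⟨n, a, f⟩) =
      pathWeight q a a (List.ofFn f) / ((n : ℝ) + 1) := by
  change RootedLoop.weight q ⟨a :: List.ofFn f, List.cons_ne_nil _ _⟩ /
    ((a :: List.ofFn f).length : ℝ) = _
  rw [RootedLoop.weight_cons]
  simp

theorem abs_pathWeight (q : Matrix A A ℝ) (b a : A) (l : List A) :
    |pathWeight q b a l| = pathWeight (q.map fun t => |t|) b a l := by
  induction l generalizing a with
  | nil => simp [pathWeight]
  | cons c l ih => simp [pathWeight, abs_mul, ih]

theorem sum_rootedLoopMeasure [Fintype A] [DecidableEq A] (q : Matrix A A ℝ) (n : ℕ) :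
    ∑ p : A × (Fin n → A), rootedLoopMeasure q (loopEquiv A ⟨n, p⟩) =
      (q ^ (n + 1)).trace / ((n : ℝ) + 1) := by
  simp only [Fintype.sum_prod_type, rootedLoopMeasure_loopEquiv, ← Finset.sum_div, sum_pathWeight]
  rfl

theorem abs_rootedLoopMeasure (q : Matrix A A ℝ) (l : RootedLoop A) :
    |rootedLoopMeasure q l| = rootedLoopMeasure (q.map fun t => |t|) l := by
  obtain ⟨⟨n, a, f⟩, rfl⟩ := (loopEquiv A).surjective l
  rw [rootedLoopMeasure_loopEquiv, rootedLoopMeasure_loopEquiv, abs_div, abs_pathWeight,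
    abs_of_nonneg (by positivity : (0 : ℝ) ≤ (n : ℝ) + 1)]

theorem loopMeasure_eq_tsum (q : Matrix A A ℝ) (ℓ : UnrootedLoop A) :
    loopMeasure q ℓ = ∑' l : {l : RootedLoop A // l.forget = ℓ}, rootedLoopMeasure q l := by
  have : Finite {l : RootedLoop A // l.forget = ℓ} := finite_representatives ℓ
  rw [tsum_eq_finsum (Set.toFinite _), loopMeasure]
  exact (finsum_set_coe_eq_finsum_mem {l : RootedLoop A | l.forget = ℓ}).symm

section Total

variable [Fintype A] [DecidableEq A] {q : Matrix A A ℝ} {r : ℝ}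

theorem AbsFormBound.summable_abs_rootedLoopMeasure (h : AbsFormBound q r) (hr : r < 1)
    (hq : q.IsHermitian) : Summable fun l => |rootedLoopMeasure q l| := by
  have hb : AbsFormBound (q.map fun t => |t|) r := h.mono fun x y => by simp
  have hs : (q.map fun t => |t|).IsHermitian := by
    ext x y
    have := congrFun (congrFun hq x) y
    simp only [Matrix.conjTranspose_apply, star_trivial] at this
    simp [this]
  simp only [abs_rootedLoopMeasure]
  rw [← (loopEquiv A).summable_iff, summable_sigma_of_nonneg]
  · refine ⟨fun n => (hasSum_fintype _).summable, ?_⟩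
    simp only [Function.comp_apply, tsum_fintype, sum_rootedLoopMeasure]
    exact (hb.hasSum_trace_pow hr hs).summable
  · intro p
    rw [Function.comp_apply, ← abs_rootedLoopMeasure]
    exact abs_nonneg _

theorem AbsFormBound.hasSum_rootedLoopMeasure (h : AbsFormBound q r) (hr : r < 1)
    (hq : q.IsHermitian) : HasSum (rootedLoopMeasure q) (-Real.log (1 - q).det) := by
  have hs := (h.summable_abs_rootedLoopMeasure hr hq).of_abs.hasSum
  have h1 := ((loopEquiv A).hasSum_iff.2 hs).sigma fun n => hasSum_fintype _
  simp only [Function.comp_apply, sum_rootedLoopMeasure] at h1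
  rwa [h1.unique (h.hasSum_trace_pow hr hq)] at hs

theorem AbsFormBound.summable_abs_loopMeasure (h : AbsFormBound q r) (hr : r < 1)
    (hq : q.IsHermitian) : Summable fun ℓ => |loopMeasure q ℓ| := by
  have h1 := ((Equiv.sigmaFiberEquiv (RootedLoop.forget (A := A))).summable_iff.2
    (h.summable_abs_rootedLoopMeasure hr hq)).sigma
  refine Summable.of_nonneg_of_le (fun _ => abs_nonneg _) (fun ℓ => ?_) h1
  rw [loopMeasure_eq_tsum]
  have : Finite {l : RootedLoop A // l.forget = ℓ} := finite_representatives ℓ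
  exact norm_tsum_le_tsum_norm (f := fun l : {l : RootedLoop A // l.forget = ℓ} =>
    rootedLoopMeasure q l) Summable.of_finite

theorem AbsFormBound.tsum_loopMeasure (h : AbsFormBound q r) (hr : r < 1)
    (hq : q.IsHermitian) : ∑' ℓ, loopMeasure q ℓ = -Real.log (1 - q).det := by
  have h1 := ((Equiv.sigmaFiberEquiv (RootedLoop.forget (A := A))).hasSum_iff.2
    (h.hasSum_rootedLoopMeasure hr hq))
  rw [← h1.tsum_eq, h1.summable.tsum_sigma]
  exact tsum_congr fun ℓ => loopMeasure_eq_tsum q ℓ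

end Total

section Scaling

theorem directedWeight_mul [DecidableEq A] (z θ : Sym2 A → ℝ) (x y : A) :
    directedWeight (fun e => z e * θ e) x y = z s(x, y) * directedWeight θ x y := by
  simp only [directedWeight]
  split_ifs <;> ring

variable [Fintype A] [DecidableEq A]

theorem weight_directedWeight_mul (z θ : Sym2 A → ℝ) (l : RootedLoop A) :
    l.weight (directedWeight fun e => z e * θ e) =
      (∏ e, z e ^ l.current e) * l.weight (directedWeight θ) := by
  simp only [RootedLoop.weight, directedWeight_mul, List.prod_map_mul]
  congr 1
  have h := Finset.prod_list_map_count (l.edges.map fun p => s(p.1, p.2)) z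
  rw [List.map_map] at h
  refine h.trans (Finset.prod_subset (Finset.subset_univ _) fun e _ he => ?_)
  rw [List.mem_toFinset] at he
  rw [List.count_eq_zero_of_not_mem he, pow_zero]

theorem loopMeasure_directedWeight_mul (z θ : Sym2 A → ℝ) (ℓ : UnrootedLoop A) :
    loopMeasure (directedWeight fun e => z e * θ e) ℓ =
      (∏ e, z e ^ ℓ.current e) * loopMeasure (directedWeight θ) ℓ := by
  rw [loopMeasure_eq_tsum, loopMeasure_eq_tsum, ← tsum_mul_left]
  refine tsum_congr fun ⟨l, hl⟩ => ?_
  subst hl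
  simp only [rootedLoopMeasure, weight_directedWeight_mul, mul_div_assoc]
  rfl

end Scaling

end Loops

section Exponential

open Filter Topology

variable {X : Type*}

theorem sum_finsupp_prod (g : X → ℕ → ℝ) (hg : ∀ i, g i 0 = 1) (S : Finset X) (t : Finset ℕ) :
    ∑ N ∈ S.finsupp (fun _ => t), N.prod g = ∏ i ∈ S, ∑ n ∈ t, g i n := by
  classical
  rw [Finset.prod_sum, Finset.finsupp, Finset.sum_map]
  refine Finset.sum_congr (by congr!) fun p _ => ?_
  rw [Finsupp.prod_of_support_subset _ (s := S) (by simpa using Finsupp.support_indicator_subset ..)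
    _ fun i _ => hg i, ← Finset.prod_attach]
  exact Finset.prod_congr rfl fun i _ => by simp [Finsupp.indicator_of_mem i.2]

theorem abs_finsupp_prod_pow_div_factorial (x : X → ℝ) (N : X →₀ ℕ) :
    |N.prod fun i n => x i ^ n / (n.factorial : ℝ)| =
      N.prod fun i n => |x i| ^ n / (n.factorial : ℝ) := by
  simp only [Finsupp.prod, Finset.abs_prod, abs_div, abs_pow, Nat.abs_cast]

theorem summable_abs_finsupp_prod_pow_div_factorial {x : X → ℝ} (hx : Summable fun i => |x i|) :
    Summable fun N : X →₀ ℕ => |N.prod fun i n => x i ^ n / (n.factorial : ℝ)| := by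
  classical
  simp only [abs_finsupp_prod_pow_div_factorial]
  have hnn : ∀ N : X →₀ ℕ, 0 ≤ N.prod fun i n => |x i| ^ n / (n.factorial : ℝ) := fun N =>
    Finset.prod_nonneg fun i _ => by positivity
  refine summable_of_sum_le hnn (c := Real.exp (∑' i, |x i|)) fun F => ?_
  let S := F.biUnion Finsupp.support
  let M := F.sup fun N => N.support.sup N
  have hF : F ⊆ S.finsupp fun _ => Finset.range (M + 1) := fun N hN => by
    rw [Finset.mem_finsupp_iff]
    refine ⟨Finset.subset_biUnion_of_mem _ hN, fun i _ => ?_⟩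
    rw [Finset.mem_range, Nat.lt_succ_iff]
    by_cases hi : i ∈ N.support
    · exact (Finset.le_sup (f := N) hi).trans
        (Finset.le_sup (f := fun N : X →₀ ℕ => N.support.sup N) hN)
    · simp [Finsupp.notMem_support_iff.1 hi]
  refine (Finset.sum_le_sum_of_subset_of_nonneg hF fun N _ _ => hnn N).trans ?_
  rw [sum_finsupp_prod _ (by simp)]
  calc ∏ i ∈ S, ∑ n ∈ Finset.range (M + 1), |x i| ^ n / (n.factorial : ℝ)
      ≤ ∏ i ∈ S, Real.exp |x i| := Finset.prod_le_prod
        (fun i _ => Finset.sum_nonneg fun n _ => by positivity)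
        fun i _ => Real.sum_le_exp_of_nonneg (abs_nonneg _) _
    _ = Real.exp (∑ i ∈ S, |x i|) := (Real.exp_sum _ _).symm
    _ ≤ _ := Real.exp_le_exp.2 (hx.sum_le_tsum S fun i _ => abs_nonneg _)

theorem hasSum_finsupp_prod_pow_div_factorial {x : X → ℝ} (hx : Summable fun i => |x i|) :
    HasSum (fun N : X →₀ ℕ => N.prod fun i n => x i ^ n / (n.factorial : ℝ))
      (Real.exp (∑' i, x i)) := by
  classical
  have hsum := (summable_abs_finsupp_prod_pow_div_factorial hx).of_abs.hasSum
  set L := ∑' N : X →₀ ℕ, N.prod fun i n => x i ^ n / (n.factorial : ℝ)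
  suffices h : Tendsto (fun S : Finset X => Real.exp (∑ i ∈ S, x i)) atTop (𝓝 L) by
    rwa [tendsto_nhds_unique h
      ((Real.continuous_exp.tendsto _).comp hx.of_abs.hasSum)] at hsum
  rw [Metric.tendsto_atTop]
  intro ε hε
  obtain ⟨F, hF⟩ := (Metric.tendsto_atTop.1 hsum) (ε / 2) (half_pos hε)
  refine ⟨F.biUnion Finsupp.support, fun S hS => ?_⟩
  refine lt_of_le_of_lt ?_ (half_lt_self hε)
  have hlim : Tendsto (fun M => ∏ i ∈ S, ∑ n ∈ Finset.range M, x i ^ n / (n.factorial : ℝ)) atTop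
      (𝓝 (Real.exp (∑ i ∈ S, x i))) := by
    rw [Real.exp_sum]
    refine tendsto_finsetProd _ fun i _ => ?_
    have := (NormedSpace.expSeries_div_hasSum_exp (x i)).tendsto_sum_nat
    rwa [← congrFun Real.exp_eq_exp_ℝ (x i)] at this
  refine le_of_tendsto (hlim.dist tendsto_const_nhds) ?_
  filter_upwards [eventually_ge_atTop ((F.sup fun N => N.support.sup N) + 1)] with M hM
  rw [← sum_finsupp_prod (fun i n => x i ^ n / (n.factorial : ℝ)) (by simp)]
  refine (hF _ fun N hN => ?_).le
  rw [Finset.mem_finsupp_iff]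
  refine ⟨(Finset.subset_biUnion_of_mem _ hN).trans hS, fun i _ => ?_⟩
  rw [Finset.mem_range]
  refine lt_of_lt_of_le (Nat.lt_succ_of_le ?_) hM
  by_cases hi : i ∈ N.support
  · exact (Finset.le_sup (f := N) hi).trans
      (Finset.le_sup (f := fun N : X →₀ ℕ => N.support.sup N) hN)
  · simp [Finsupp.notMem_support_iff.1 hi]

theorem hasSum_pi_prod_pow_div_factorial [Fintype X] (x : X → ℝ) :
    HasSum (fun k : X → ℕ => ∏ i, (x i ^ k i / ((k i).factorial : ℝ)))
      (Real.exp (∑ i, x i)) := by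
  have h := hasSum_finsupp_prod_pow_div_factorial (x := x) Summable.of_finite
  rw [tsum_fintype] at h
  rw [← Finsupp.equivFunOnFinite.hasSum_iff]
  convert! h using 2 with N
  exact (Finsupp.prod_fintype N (fun i n => x i ^ n / (n.factorial : ℝ)) (by simp)).symm

end Exponential

section Uniqueness

open Filter Topology

theorem eq_zero_of_hasSum_mul_pow_zero {b : ℕ → ℝ}
    (h : ∀ t : ℝ, |t| ≤ 1 → HasSum (fun n => b n * t ^ n) 0) (n : ℕ) : b n = 0 := by
  have hp : HasFPowerSeriesAt (0 : ℝ → ℝ) (FormalMultilinearSeries.ofScalars ℝ b) 0 := by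
    rw [hasFPowerSeriesAt_iff]
    filter_upwards [Metric.ball_mem_nhds (0 : ℝ) one_pos] with t ht
    rw [mem_ball_zero_iff, Real.norm_eq_abs] at ht
    simpa [FormalMultilinearSeries.coeff_ofScalars, mul_comm] using h t ht.le
  have h0 := congrArg (fun p => FormalMultilinearSeries.coeff p n) hp.eq_zero
  rw [FormalMultilinearSeries.coeff_ofScalars] at h0
  exact h0.trans rfl

theorem tsum_ite_eq_zero_of_tsum_mul_pow_eq_zero {K : Type*} {f : K → ℝ} (p : K → ℕ)
    (hf : Summable fun k => |f k|) (h : ∀ t : ℝ, |t| ≤ 1 → ∑' k, f k * t ^ p k = 0) (n : ℕ) :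
    ∑' k, (if p k = n then f k else 0) = 0 := by
  have key : ∀ t : ℝ, |t| ≤ 1 →
      HasSum (fun n => (∑' k : {k // p k = n}, f k) * t ^ n) 0 := fun t ht => by
    have hs : Summable fun k => f k * t ^ p k := by
      refine Summable.of_norm_bounded hf fun k => ?_
      rw [Real.norm_eq_abs, abs_mul, abs_pow]
      exact mul_le_of_le_one_right (abs_nonneg _) (pow_le_one₀ (abs_nonneg _) ht)
    have h1 := (Equiv.sigmaFiberEquiv p).hasSum_iff.2 hs.hasSum
    rw [h t ht] at h1
    have h2 := h1.sigma fun n => (h1.summable.sigma_factor n).hasSum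
    refine h2.congr_fun fun n => ?_
    rw [← tsum_mul_right]
    refine tsum_congr fun ⟨k, hk⟩ => ?_
    subst hk
    rfl
  refine Eq.trans ?_ (eq_zero_of_hasSum_mul_pow_zero key n)
  refine Eq.trans (tsum_congr fun k => ?_) (tsum_subtype {k | p k = n} f).symm
  simp [Set.indicator_apply]

theorem eq_zero_of_tsum_mul_prod_pow_eq_zero {E : Type*} [Fintype E] {c : (E → ℕ) → ℝ}
    (hc : Summable fun k => |c k|)
    (h : ∀ z : E → ℝ, (∀ e, |z e| ≤ 1) → ∑' k, c k * ∏ e, z e ^ k e = 0) (κ : E → ℕ) :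
    c κ = 0 := by
  classical
  let u (S : Finset E) (z : E → ℝ) (e : E) (n : ℕ) : ℝ :=
    if e ∈ S then (if n = κ e then 1 else 0) else z e ^ n
  have hu : ∀ S z, (∀ e, |z e| ≤ 1) → ∀ e n, |u S z e n| ≤ 1 := fun S z hz e n => by
    simp only [u]
    split_ifs
    · simp
    · simp
    · rw [abs_pow]
      exact pow_le_one₀ (abs_nonneg _) (hz e)
  have claim : ∀ S : Finset E, ∀ z : E → ℝ, (∀ e, |z e| ≤ 1) →
      ∑' k, c k * ∏ e, u S z e (k e) = 0 := fun S => by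
    induction S using Finset.induction_on with
    | empty => simpa [u] using h
    | insert a S ha ih =>
      intro z hz
      have hsum : Summable fun k => |c k * ∏ e ∈ Finset.univ.erase a, u S z e (k e)| := by
        refine Summable.of_nonneg_of_le (fun _ => abs_nonneg _) (fun k => ?_) hc
        rw [abs_mul, Finset.abs_prod]
        exact mul_le_of_le_one_right (abs_nonneg _)
          (Finset.prod_le_one (fun _ _ => abs_nonneg _) fun e _ => hu S z hz e _)
      have := tsum_ite_eq_zero_of_tsum_mul_pow_eq_zero (fun k : E → ℕ => k a) hsum
        (fun t ht => by
          rw [← ih (Function.update z a t) fun e => by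
            by_cases hea : e = a
            · subst hea; simpa
            · simpa [hea] using hz e]
          refine tsum_congr fun k => ?_
          rw [← Finset.mul_prod_erase _ _ (Finset.mem_univ a), mul_assoc,
            mul_comm (u S (Function.update z a t) a (k a))]
          congr 2
          · refine Finset.prod_congr rfl fun e he => ?_
            simp [u, Finset.ne_of_mem_erase he]
          · simp [u, ha]) (κ a)
      rw [← this]
      refine tsum_congr fun k => ?_
      have h1 : ∏ e ∈ Finset.univ.erase a, u (insert a S) z e (k e) =
          ∏ e ∈ Finset.univ.erase a, u S z e (k e) :=
        Finset.prod_congr rfl fun e he => by simp [u, Finset.ne_of_mem_erase he]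
      rw [← Finset.mul_prod_erase _ _ (Finset.mem_univ a), h1]
      by_cases hk : k a = κ a <;> simp [u, hk]
  have h1 := claim Finset.univ 0 (by simp)
  rw [tsum_eq_single κ] at h1
  · simpa [u] using h1
  · intro k hk
    obtain ⟨e, he⟩ := Function.ne_iff.1 hk
    rw [Finset.prod_eq_zero (Finset.mem_univ e), mul_zero]
    simp [u, he]

end Uniqueness

section Parity

variable {A : Type*} [DecidableEq A]

theorem touch_mk (a b x : A) :
    touch s(a, b) x = (if a = x then 1 else 0) + (if b = x then 1 else 0) := by
  unfold touch
  by_cases ha : a = x <;> by_cases hb : b = x <;> simp [ha, hb, Ne.symm]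

variable [Fintype A]

/-- The number of edge ends of `k` at `x`. -/
def endCount (k : Sym2 A → ℕ) (x : A) : ℕ := ∑ e, k e * touch e x

theorem localTime_eq_endCount (k : Sym2 A → ℕ) (x : A) : localTime k x = endCount k x / 2 := by
  simp only [localTime, endCount]
  push_cast
  ring

theorem sum_touch (e : Sym2 A) : ∑ x, touch e x = 2 := by
  induction e with
  | h a b => simp [touch_mk, Finset.sum_add_distrib]

theorem sum_endCount (k : Sym2 A → ℕ) : ∑ x, endCount k x = 2 * ∑ e, k e := by
  simp only [endCount]
  rw [Finset.sum_comm]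
  simp only [← Finset.mul_sum, sum_touch, mul_comm 2]
  rw [Finset.sum_mul]

theorem IsCurrent.exists_endCount_eq {k : Sym2 A → ℕ} (hk : IsCurrent k) :
    ∃ m : A → ℕ, ∀ x, endCount k x = 2 * m x := by
  suffices h : ∀ x, ∃ m : ℕ, endCount k x = 2 * m from Classical.skolem.1 h
  intro x
  obtain ⟨n, hn⟩ := hk x
  rw [localTime_eq_endCount, div_eq_iff two_ne_zero] at hn
  have : (endCount k x : ℤ) = n * 2 := by exact_mod_cast hn
  exact ⟨n.toNat, by omega⟩

theorem isCurrent_zero : IsCurrent (0 : Sym2 A → ℕ) := fun _ => ⟨0, by simp [localTime]⟩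

theorem IsCurrent.add {k k' : Sym2 A → ℕ} (hk : IsCurrent k) (hk' : IsCurrent k') :
    IsCurrent (k + k') := fun x => by
  obtain ⟨n, hn⟩ := hk x
  obtain ⟨n', hn'⟩ := hk' x
  refine ⟨n + n', ?_⟩
  push_cast
  rw [← hn, ← hn']
  simp [localTime, add_mul, Finset.sum_add_distrib, mul_add]

theorem IsCurrent.nsmul {k : Sym2 A → ℕ} (hk : IsCurrent k) (n : ℕ) : IsCurrent (n • k) := by
  induction n with
  | zero => simpa using isCurrent_zero
  | succ n ih => rw [succ_nsmul]; exact ih.add hk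

theorem endCount_rootedLoop_current (l : RootedLoop A) (x : A) :
    endCount l.current x = 2 * l.1.count x := by
  have hcount : ∀ l : List A, (l.map fun a => if a = x then 1 else 0).sum = l.count x := fun l => by
    induction l with
    | nil => rfl
    | cons a l ih => simp [ih, List.count_cons, add_comm]
  have h := Finset.sum_list_map_count (l.edges.map fun p => s(p.1, p.2)) fun e => touch e x
  rw [Finset.sum_subset (Finset.subset_univ _) fun e _ he => by
    rw [List.mem_toFinset] at he
    rw [List.count_eq_zero_of_not_mem he, zero_smul]] at h
  have h' : endCount l.current x =
    ((l.edges.map fun p => s(p.1, p.2)).map fun e => touch e x).sum := h.symm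
  have h1 : l.edges.map Prod.fst = l.1 := List.map_fst_zip (by simp)
  have h2 : l.edges.map Prod.snd = l.1.rotate 1 := List.map_snd_zip (by simp)
  have h3 := hcount (l.edges.map Prod.fst)
  have h4 := hcount (l.edges.map Prod.snd)
  rw [h1, ← h1, List.map_map, h1] at h3
  rw [h2, ← h2, List.map_map, h2, (List.rotate_perm _ _).count_eq] at h4
  rw [h', two_mul]
  nth_rewrite 1 [← h3]
  rw [← h4, ← List.sum_map_add, List.map_map]
  simp only [Function.comp_def, touch_mk]

theorem isCurrent_unrootedLoop_current (ℓ : UnrootedLoop A) : IsCurrent ℓ.current := by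
  obtain ⟨l, rfl⟩ := Quotient.exists_rep ℓ
  intro x
  refine ⟨l.1.count x, ?_⟩
  have : endCount (UnrootedLoop.current (Quotient.mk _ l)) x = 2 * l.1.count x :=
    endCount_rootedLoop_current l x
  rw [localTime_eq_endCount, this]
  simp

theorem isCurrent_soupCurrent (N : UnrootedLoop A →₀ ℕ) : IsCurrent (soupCurrent N) :=
  Finset.sum_induction _ IsCurrent (fun _ _ => IsCurrent.add) isCurrent_zero
    fun ℓ _ => (isCurrent_unrootedLoop_current ℓ).nsmul _

end Parity

section Gaussian

open MeasureTheory

theorem integral_exp_neg_half_sq :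
    ∫ t : ℝ, Real.exp (-(1 / 2) * t ^ 2) = Real.sqrt (2 * Real.pi) := by
  rw [integral_gaussian]
  congr 1
  ring

theorem integral_pow_mul_exp_neg_half_sq (m : ℕ) :
    ∫ t : ℝ, t ^ (2 * m) * Real.exp (-(1 / 2) * t ^ 2) =
      Real.sqrt (2 * Real.pi) * (2 ^ m * (Real.Gamma (m + 1 / 2) / Real.sqrt Real.pi)) := by
  let g (s : ℝ) : ℝ := s ^ ((2 * m : ℕ) : ℝ) * Real.exp (-(1 / 2) * s ^ (2 : ℝ))
  have h1 : ∀ t : ℝ, t ^ (2 * m) * Real.exp (-(1 / 2) * t ^ 2) = g |t| := fun t => by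
    simp only [g, Real.rpow_natCast, Real.rpow_two, sq_abs]
    rw [pow_mul, pow_mul, sq_abs]
  simp only [h1]
  rw [integral_comp_abs (f := g), integral_rpow_mul_exp_neg_mul_rpow two_pos
    (by have : (0 : ℝ) ≤ ((2 * m : ℕ) : ℝ) := Nat.cast_nonneg _
        linarith) (by norm_num)]
  have h2 : (((2 * m : ℕ) : ℝ) + 1) / 2 = m + 1 / 2 := by push_cast; ring
  have h3 : (1 / 2 : ℝ) ^ (-(((2 * m : ℕ) : ℝ) + 1) / 2) = 2 ^ m * Real.sqrt 2 := by
    rw [neg_div, h2, one_div, Real.inv_rpow two_pos.le, Real.rpow_neg two_pos.le, inv_inv,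
      Real.rpow_add two_pos, Real.rpow_natCast, ← one_div, Real.sqrt_eq_rpow]
  rw [h2, h3, Real.sqrt_mul two_pos.le]
  have : Real.sqrt Real.pi ≠ 0 := (Real.sqrt_pos.2 Real.pi_pos).ne'
  field_simp

variable {A : Type*} [Fintype A]

theorem exp_neg_half_sum_sq (w : A → ℝ) :
    Real.exp (-(1 / 2) * ∑ x, w x ^ 2) = ∏ x, Real.exp (-(1 / 2) * w x ^ 2) := by
  rw [← Real.exp_sum, Finset.mul_sum]

theorem integral_exp_neg_half_dotProduct_mulVec [DecidableEq A] {M : Matrix A A ℝ}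
    (hM : M.PosDef) :
    ∫ v : A → ℝ, Real.exp (-(1 / 2) * (v ⬝ᵥ M.mulVec v)) =
      Real.sqrt (2 * Real.pi) ^ Fintype.card A / Real.sqrt M.det := by
  obtain ⟨B, hB⟩ : ∃ B : Matrix A A ℝ, M = star B * B := by
    open scoped MatrixOrder Matrix.Norms.L2Operator in
    exact CStarAlgebra.nonneg_iff_eq_star_mul_self.mp hM.posSemidef.nonneg
  have hdet : M.det = B.det ^ 2 := by
    rw [hB, Matrix.det_mul, Matrix.star_eq_conjTranspose, Matrix.det_conjTranspose]
    simp [sq]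
  have hB0 : B.det ≠ 0 := fun h => by
    have := hM.det_pos
    simp [hdet, h] at this
  have hform : ∀ v, v ⬝ᵥ M.mulVec v = ∑ x, (Matrix.toLin' B v x) ^ 2 := fun v => by
    rw [hB, ← Matrix.mulVec_mulVec, Matrix.dotProduct_mulVec, Matrix.star_eq_conjTranspose,
      Matrix.vecMul_conjTranspose]
    simp [dotProduct, sq]
  simp only [hform]
  have hcont : Continuous fun w : A → ℝ => Real.exp (-(1 / 2) * ∑ x, w x ^ 2) := by fun_prop
  rw [← integral_map (μ := volume) (φ := Matrix.toLin' B)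
    (f := fun w : A → ℝ => Real.exp (-(1 / 2) * ∑ x, w x ^ 2))
    (LinearMap.continuous_of_finiteDimensional _).aemeasurable hcont.aestronglyMeasurable,
    Real.map_matrix_volume_pi_eq_smul_volume_pi hB0, integral_smul_measure]
  simp only [exp_neg_half_sum_sq]
  rw [integral_fintype_prod_volume_eq_pow fun t : ℝ => Real.exp (-(1 / 2) * t ^ 2),
    integral_exp_neg_half_sq, ENNReal.toReal_ofReal (abs_nonneg _), hdet, Real.sqrt_sq_eq_abs,
    abs_inv, smul_eq_mul, div_eq_inv_mul]

end Gaussian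

section Expansion

open MeasureTheory

variable {A : Type*} [Fintype A] [DecidableEq A]

/-- The product of the values of `v` at the two ends of an edge. -/
def edgeProd (v : A → ℝ) (e : Sym2 A) : ℝ := ∏ x, v x ^ touch e x

theorem edgeProd_mk (v : A → ℝ) (a b : A) : edgeProd v s(a, b) = v a * v b := by
  simp only [edgeProd, touch_mk, pow_add, Finset.prod_mul_distrib]
  simp [pow_ite]

theorem prod_edgeProd_pow (v : A → ℝ) (k : Sym2 A → ℕ) :
    ∏ e, edgeProd v e ^ k e = ∏ x, v x ^ endCount k x := by
  simp only [edgeProd, endCount, ← Finset.prod_pow, ← pow_mul]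
  rw [Finset.prod_comm]
  refine Finset.prod_congr rfl fun x _ => ?_
  rw [Finset.prod_pow_eq_pow_sum]
  simp only [mul_comm]

theorem sum_directedWeight_mul_mul (θ : Sym2 A → ℝ) (v : A → ℝ) :
    ∑ x, ∑ y, directedWeight θ x y * v x * v y = ∑ e, θ e * edgeProd v e := by
  rw [← Fintype.sum_prod_type', ← Finset.sum_fiberwise _ fun p : A × A => s(p.1, p.2)]
  refine Finset.sum_congr rfl fun e _ => ?_
  induction e with
  | h a b =>
    rw [edgeProd_mk]
    by_cases hab : a = b
    · subst hab
      have : (Finset.univ.filter fun p : A × A => s(p.1, p.2) = s(a, a)) = {(a, a)} := by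
        ext ⟨x, y⟩
        simp
      rw [this, Finset.sum_singleton]
      simp [directedWeight, mul_assoc]
    · have : (Finset.univ.filter fun p : A × A => s(p.1, p.2) = s(a, b)) = {(a, b), (b, a)} := by
        ext ⟨x, y⟩
        simp
      rw [this, Finset.sum_pair (by simp [hab])]
      simp only [directedWeight, if_neg hab, if_neg (Ne.symm hab), Sym2.eq_swap (a := b)]
      ring

omit [Fintype A] in
theorem directedWeight_isSymm (θ : Sym2 A → ℝ) : (directedWeight θ).IsSymm := by
  ext x y
  simp only [Matrix.transpose_apply, directedWeight, Sym2.eq_swap (a := y), eq_comm (a := y)]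

omit [Fintype A] in
theorem directedWeight_isHermitian (θ : Sym2 A → ℝ) : (directedWeight θ).IsHermitian := by
  have := directedWeight_isSymm θ
  rwa [Matrix.IsHermitian, Matrix.conjTranspose_eq_transpose_of_trivial]

omit [Fintype A] in
theorem abs_directedWeight (θ : Sym2 A → ℝ) (x y : A) :
    |directedWeight θ x y| = directedWeight (fun e => |θ e|) x y := by
  simp only [directedWeight]
  split_ifs
  · rfl
  · rw [abs_div, abs_two]

/-- The coefficient in the expansion of `exp (1/2 ∑ θ_e v^e)` in powers of `v`. -/
def expCoeff (θ : Sym2 A → ℝ) (k : Sym2 A → ℕ) : ℝ :=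
  ∏ e, ((θ e / 2) ^ k e / ((k e).factorial : ℝ))

theorem hasSum_expCoeff_mul (θ : Sym2 A → ℝ) (v : A → ℝ) :
    HasSum (fun k : Sym2 A → ℕ => expCoeff θ k * ∏ x, v x ^ endCount k x)
      (Real.exp (1 / 2 * ∑ e, θ e * edgeProd v e)) := by
  convert! hasSum_pi_prod_pow_div_factorial fun e => θ e / 2 * edgeProd v e using 2 with k
  · rw [← prod_edgeProd_pow, expCoeff, ← Finset.prod_mul_distrib]
    exact Finset.prod_congr rfl fun e _ => by ring
  · rw [Finset.mul_sum]
    exact Finset.sum_congr rfl fun e _ => by ring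

omit [DecidableEq A] in
theorem abs_expCoeff (θ : Sym2 A → ℝ) (k : Sym2 A → ℕ) :
    |expCoeff θ k| = expCoeff (fun e => |θ e|) k := by
  simp [expCoeff, Finset.abs_prod, abs_div]

omit [DecidableEq A] in
theorem expCoeff_mul (z θ : Sym2 A → ℝ) (k : Sym2 A → ℕ) :
    expCoeff (fun e => z e * θ e) k = (∏ e, z e ^ k e) * expCoeff θ k := by
  rw [expCoeff, expCoeff, ← Finset.prod_mul_distrib]
  exact Finset.prod_congr rfl fun e _ => by rw [mul_div_assoc, mul_pow, mul_div_assoc]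

/-- The Gaussian moment (up to normalization) of the monomial in which `v x` has exponent
`endCount k x`. -/
def gaussianMoment (k : Sym2 A → ℕ) : ℝ :=
  ∏ x : A, ∫ t : ℝ, t ^ endCount k x * Real.exp (-(1 / 2) * t ^ 2)

theorem integrable_exp_half_edgeProd_abs {θ : Sym2 A → ℝ} {r : ℝ}
    (h : AbsFormBound (directedWeight θ) r) (hr : r < 1) :
    Integrable fun v : A → ℝ => Real.exp (1 / 2 * ∑ e, |θ e| * edgeProd (fun x => |v x|) e) *
      Real.exp (-(1 / 2) * ∑ x, v x ^ 2) := by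
  have hg : Integrable fun v : A → ℝ => ∏ x, Real.exp (-((1 - r) / 2) * v x ^ 2) :=
    Integrable.fintype_prod (f := fun _ t => Real.exp (-((1 - r) / 2) * t ^ 2)) fun _ =>
      integrable_exp_neg_mul_sq (by linarith)
  refine hg.mono' (Continuous.aestronglyMeasurable ?_) (Filter.Eventually.of_forall fun v => ?_)
  · unfold edgeProd
    fun_prop
  · rw [← Real.exp_add, ← Real.exp_sum, ← Finset.mul_sum, Real.norm_eq_abs, Real.abs_exp,
      Real.exp_le_exp, ← sum_directedWeight_mul_mul]
    have := h (fun x => |v x|) fun x => abs_nonneg _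
    simp only [abs_directedWeight, sq_abs] at this
    linarith

theorem hasSum_expCoeff_mul_gaussianMoment {θ : Sym2 A → ℝ} {r : ℝ}
    (h : AbsFormBound (directedWeight θ) r) (hr : r < 1) :
    HasSum (fun k => expCoeff θ k * gaussianMoment k)
      (Real.sqrt (2 * Real.pi) ^ Fintype.card A / Real.sqrt (1 - directedWeight θ).det) := by
  rw [← integral_exp_neg_half_dotProduct_mulVec
    (h.posDef_one_sub hr (directedWeight_isHermitian θ))]
  have hexp : ∀ v : A → ℝ, Real.exp (-(1 / 2) * (v ⬝ᵥ (1 - directedWeight θ).mulVec v)) =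
      Real.exp (1 / 2 * ∑ e, θ e * edgeProd v e) * Real.exp (-(1 / 2) * ∑ x, v x ^ 2) :=
    fun v => by
    rw [← Real.exp_add, Matrix.sub_mulVec, Matrix.one_mulVec, dotProduct_sub,
      dotProduct_mulVec_eq_sum, sum_directedWeight_mul_mul]
    congr 1
    simp only [dotProduct, sq]
    ring
  have hterm : ∀ k : Sym2 A → ℕ, expCoeff θ k * gaussianMoment k =
      ∫ v : A → ℝ, (expCoeff θ k * ∏ x, v x ^ endCount k x) *
        Real.exp (-(1 / 2) * ∑ x, v x ^ 2) := fun k => by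
    rw [gaussianMoment, ← integral_fintype_prod_volume_eq_prod
      (f := fun x t => t ^ endCount k x * Real.exp (-(1 / 2) * t ^ 2)), ← integral_const_mul]
    simp only [Finset.prod_mul_distrib, exp_neg_half_sum_sq, mul_assoc]
  simp only [hexp, hterm]
  have habs := fun v : A → ℝ => (hasSum_expCoeff_mul (fun e => |θ e|) fun x => |v x|).mul_right
    (Real.exp (-(1 / 2) * ∑ x, v x ^ 2))
  refine hasSum_integral_of_dominated_convergence
    (fun k v => expCoeff (fun e => |θ e|) k * (∏ x, |v x| ^ endCount k x) *
      Real.exp (-(1 / 2) * ∑ x, v x ^ 2))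
    (fun k => Continuous.aestronglyMeasurable (by fun_prop))
    (fun k => Filter.Eventually.of_forall fun v => ?_)
    (Filter.Eventually.of_forall fun v => (habs v).summable)
    ?_ (Filter.Eventually.of_forall fun v => (hasSum_expCoeff_mul θ v).mul_right _)
  · rw [Real.norm_eq_abs, abs_mul, abs_mul, Real.abs_exp, abs_expCoeff, Finset.abs_prod]
    simp only [abs_pow, le_refl]
  · simp only [fun v => (habs v).tsum_eq]
    exact integrable_exp_half_edgeProd_abs h hr

theorem gaussianMoment_eq {k : Sym2 A → ℕ} (hk : IsCurrent k) :
    gaussianMoment k = Real.sqrt (2 * Real.pi) ^ Fintype.card A * (2 ^ (∑ e, k e) *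
      ∏ x : A, (Real.Gamma (localTime k x + 1 / 2) / Real.sqrt Real.pi)) := by
  obtain ⟨m, hm⟩ := hk.exists_endCount_eq
  have h1 : ∀ x, localTime k x = m x := fun x => by simp [localTime_eq_endCount, hm]
  have h2 : ∑ e, k e = ∑ x, m x := by
    have := sum_endCount k
    simp only [hm, ← Finset.mul_sum] at this
    omega
  simp only [gaussianMoment, hm, h1, integral_pow_mul_exp_neg_half_sq, Finset.prod_mul_distrib,
    Finset.prod_const, Finset.card_univ, h2, Finset.prod_pow_eq_pow_sum]

omit [DecidableEq A] in
theorem expCoeff_eq (θ : Sym2 A → ℝ) (k : Sym2 A → ℕ) :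
    expCoeff θ k * 2 ^ (∑ e, k e) =
      (∏ e, (1 / ((k e).factorial : ℝ))) * ∏ e, θ e ^ k e := by
  rw [expCoeff, ← Finset.prod_pow_eq_pow_sum, ← Finset.prod_mul_distrib,
    ← Finset.prod_mul_distrib]
  refine Finset.prod_congr rfl fun e _ => ?_
  rw [div_pow]
  field_simp

end Expansion

section Soup

variable {A : Type*} [Fintype A] [DecidableEq A]

/-- The unnormalized loop soup at time `1/2`. -/
def soupWeight (q : Matrix A A ℝ) (N : UnrootedLoop A →₀ ℕ) : ℝ :=
  N.prod fun ℓ n => (1 / 2 * loopMeasure q ℓ) ^ n / (n.factorial : ℝ)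

theorem soupWeight_directedWeight_mul (z θ : Sym2 A → ℝ) (N : UnrootedLoop A →₀ ℕ) :
    soupWeight (directedWeight fun e => z e * θ e) N =
      soupWeight (directedWeight θ) N * ∏ e, z e ^ soupCurrent N e := by
  have h : ∏ e, z e ^ soupCurrent N e = N.prod fun ℓ n => (∏ e, z e ^ ℓ.current e) ^ n := by
    simp only [soupCurrent, Finsupp.sum, Finset.sum_apply, Finsupp.prod, ← Finset.prod_pow,
      Pi.smul_apply, smul_eq_mul, ← pow_mul]
    rw [Finset.prod_comm]
    refine Finset.prod_congr rfl fun e _ => ?_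
    rw [Finset.prod_pow_eq_pow_sum]
    simp only [mul_comm]
  rw [h, soupWeight, soupWeight, ← Finsupp.prod_mul]
  refine Finsupp.prod_congr fun ℓ _ => ?_
  rw [loopMeasure_directedWeight_mul]
  ring

variable {q : Matrix A A ℝ} {r : ℝ}

theorem AbsFormBound.summable_abs_soupWeight (h : AbsFormBound q r) (hr : r < 1)
    (hq : q.IsHermitian) : Summable fun N => |soupWeight q N| :=
  summable_abs_finsupp_prod_pow_div_factorial <| by
    simpa only [abs_mul] using (h.summable_abs_loopMeasure hr hq).mul_left |(1 / 2 : ℝ)|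

theorem AbsFormBound.exp_half_tsum_loopMeasure (h : AbsFormBound q r) (hr : r < 1)
    (hq : q.IsHermitian) :
    Real.exp (1 / 2 * ∑' ℓ, loopMeasure q ℓ) = 1 / Real.sqrt (1 - q).det := by
  rw [h.tsum_loopMeasure hr hq, mul_neg, Real.exp_neg, one_div_mul_eq_div, Real.exp_half,
    Real.exp_log (h.det_one_sub_pos hr hq), one_div]

theorem AbsFormBound.hasSum_soupWeight (h : AbsFormBound q r) (hr : r < 1)
    (hq : q.IsHermitian) : HasSum (soupWeight q) (1 / Real.sqrt (1 - q).det) := by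
  rw [← h.exp_half_tsum_loopMeasure hr hq, ← tsum_mul_left]
  exact hasSum_finsupp_prod_pow_div_factorial <| by
    simpa only [abs_mul] using (h.summable_abs_loopMeasure hr hq).mul_left |(1 / 2 : ℝ)|

theorem AbsFormBound.loopSoup_eq (h : AbsFormBound q r) (hr : r < 1)
    (hq : q.IsHermitian) (N : UnrootedLoop A →₀ ℕ) :
    loopSoup q (1 / 2) N = Real.sqrt (1 - q).det * soupWeight q N := by
  rw [loopSoup, soup, neg_mul, Real.exp_neg, h.exp_half_tsum_loopMeasure hr hq, one_div (√_),
    inv_inv, soupWeight]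

/-- The total unnormalized weight of the soups with edge counts `k`. -/
def currentWeight (q : Matrix A A ℝ) (k : Sym2 A → ℕ) : ℝ :=
  ∑' N : {N : UnrootedLoop A →₀ ℕ // soupCurrent N = k}, soupWeight q N

variable {θ : Sym2 A → ℝ}

theorem AbsFormBound.directedWeight_mul {z : Sym2 A → ℝ}
    (h : AbsFormBound (directedWeight θ) r) (hz : ∀ e, |z e| ≤ 1) :
    AbsFormBound (directedWeight fun e => z e * θ e) r :=
  h.mono fun x y => by
    rw [LoopSoup.directedWeight_mul, abs_mul]
    exact mul_le_of_le_one_left (abs_nonneg _) (hz _)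

theorem hasSum_currentWeight_mul (h : AbsFormBound (directedWeight θ) r) (hr : r < 1)
    {z : Sym2 A → ℝ} (hz : ∀ e, |z e| ≤ 1) :
    HasSum (fun k => currentWeight (directedWeight θ) k * ∏ e, z e ^ k e)
      (1 / Real.sqrt (1 - directedWeight fun e => z e * θ e).det) := by
  have h1 := (Equiv.sigmaFiberEquiv (soupCurrent (A := A))).hasSum_iff.2
    ((h.directedWeight_mul hz).hasSum_soupWeight hr (directedWeight_isHermitian _))
  refine (h1.sigma fun k => (h1.summable.sigma_factor k).hasSum).congr_fun fun k => ?_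
  rw [currentWeight, ← tsum_mul_right]
  refine tsum_congr fun ⟨N, hN⟩ => ?_
  subst hN
  exact (soupWeight_directedWeight_mul z θ N).symm

theorem currentWeight_eq (h : AbsFormBound (directedWeight θ) r) (hr : r < 1) (k : Sym2 A → ℕ) :
    currentWeight (directedWeight θ) k =
      expCoeff θ k * gaussianMoment k / Real.sqrt (2 * Real.pi) ^ Fintype.card A := by
  have hpi : Real.sqrt (2 * Real.pi) ^ Fintype.card A ≠ 0 :=
    pow_ne_zero _ (Real.sqrt_pos.2 (by positivity)).ne'
  have key : ∀ z : Sym2 A → ℝ, (∀ e, |z e| ≤ 1) →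
      HasSum (fun k => (currentWeight (directedWeight θ) k -
        expCoeff θ k * gaussianMoment k / Real.sqrt (2 * Real.pi) ^ Fintype.card A) *
          ∏ e, z e ^ k e) 0 := fun z hz => by
    have h1 := (hasSum_expCoeff_mul_gaussianMoment (h.directedWeight_mul hz) hr).div_const
      (Real.sqrt (2 * Real.pi) ^ Fintype.card A)
    rw [div_div_cancel_left' hpi, ← one_div] at h1
    convert! (hasSum_currentWeight_mul h hr hz).sub h1 using 2 with k
    · rw [expCoeff_mul]
      ring
    · simp
  have h1 := key (fun _ => 1) (by simp)
  simp only [one_pow, Finset.prod_const_one, mul_one] at h1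
  exact sub_eq_zero.1 (eq_zero_of_tsum_mul_prod_pow_eq_zero
    (c := fun k => currentWeight (directedWeight θ) k -
        expCoeff θ k * gaussianMoment k / Real.sqrt (2 * Real.pi) ^ Fintype.card A)
    h1.summable.abs (fun z hz => (key z hz).tsum_eq) k)

end Soup

end LoopSoup

end

theorem mainTheorem1 {A : Type*} [Fintype A] [DecidableEq A] (θ : Sym2 A → ℝ)
    (hθ : LoopSoup.IsIntegrableWeight (LoopSoup.directedWeight θ)) :
    Summable (fun ℓ : LoopSoup.UnrootedLoop A =>
      |LoopSoup.loopMeasure (LoopSoup.directedWeight θ) ℓ|) ∧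
    Summable (fun N : LoopSoup.UnrootedLoop A →₀ ℕ =>
      |LoopSoup.loopSoup (LoopSoup.directedWeight θ) (1 / 2) N|) ∧
    (∀ N : LoopSoup.UnrootedLoop A →₀ ℕ, LoopSoup.IsCurrent (LoopSoup.soupCurrent N)) ∧
    0 < (1 - LoopSoup.directedWeight θ).det ∧
    ∀ k : Sym2 A → ℕ, LoopSoup.IsCurrent k →
      LoopSoup.currentMeasure (LoopSoup.directedWeight θ) (1 / 2) k =
        Real.sqrt (1 - LoopSoup.directedWeight θ).det *
          (∏ x : A, (Real.Gamma (LoopSoup.localTime k x + 1 / 2) / Real.sqrt Real.pi)) *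
          (∏ e : Sym2 A, (1 / ((k e).factorial : ℝ))) *
          ∏ e : Sym2 A, θ e ^ k e := by
  obtain ⟨r, -, hr, h⟩ := LoopSoup.exists_absFormBound (LoopSoup.directedWeight_isSymm θ) hθ
  have hq := LoopSoup.directedWeight_isHermitian θ
  refine ⟨h.summable_abs_loopMeasure hr hq, ?_, LoopSoup.isCurrent_soupCurrent,
    h.det_one_sub_pos hr hq, fun k hk => ?_⟩
  · simp only [h.loopSoup_eq hr hq, abs_mul]
    exact (h.summable_abs_soupWeight hr hq).mul_left _
  · simp only [LoopSoup.currentMeasure, h.loopSoup_eq hr hq]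
    rw [tsum_mul_left]
    change _ * LoopSoup.currentWeight (LoopSoup.directedWeight θ) k = _
    have hpi : Real.sqrt (2 * Real.pi) ^ Fintype.card A ≠ 0 :=
      pow_ne_zero _ (Real.sqrt_pos.2 (by positivity)).ne'
    rw [LoopSoup.currentWeight_eq h hr, LoopSoup.gaussianMoment_eq hk, mul_left_comm,
      mul_div_cancel_left₀ _ hpi, ← mul_assoc (LoopSoup.expCoeff θ k), LoopSoup.expCoeff_eq]
    ring
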